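/- **Setting.** Let $r,\ell\ge 1$ be integers, $\zeta_\ell=e^{2\pi i/\ell}$ and $k=\mathbb{Q}(\zeta_\ell)\subset\mathbb{C}$. Put $\square^n=(\mathbb{P}^1\setminus\{1\})^n$ with coordinates $z_1,\dots,z_n$; its faces are given by setting some of the $z_i$ equal to $0$ or $\infty$. Let $c^p(k,n)$ be the group of algebraic cycles of codimension $p$ on $\square^n_k$ whose components meet all faces properly, $d^p(k,n)$ the subgroup generated by the subvarieties that are constant in some $z_i$ (pulled back along the projection forgetting $z_i$), and $Z^p(k,n)=c^p(k,n)/d^p(k,n)$, with boundary $\partial Z=\sum_{i=1}^n(-1)^i(Z\cdot\{z_i=\infty\}-Z\cdot\{z_i=0\})$. Let $N^p(k,n)\subset Z^p(k,n)$ be the group of classes of those $Z\in c^p(k,n)$ with $Z\cdot\{z_i=0\}=Z\cdot\{z_i=\infty\}=0$ for all $i<n$. Let $T_z=\{z\in\mathbb{R}_{<0}\}$, and let $N^p_{\mathbb{R}}(k,n)\subset N^p(k,n)$ consist of the classes that can also be represented by cycles with $\mathbb{R}$-proper components $V$: for every face $F$ and every initial segment $I$ of the set of coordinates that are free on $F$,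 the set $V(\mathbb{C})\cap F\cap\bigcap_{i\in I}T_{z_i}$ is empty or of real dimension at most $2(n-p)-2\operatorname{codim}F-|I|$. For $Z\in N^r_{\mathbb{R}}(k,2r-1)$ with $\partial Z=0$ put $$\mathscr{R}(Z)=\frac{1}{(2\pi i)^{r-1}}\int_Z R_{2r-1}\in\mathbb{C},\qquad R_n=\log(z_1)\frac{dz_2}{z_2}\wedge\cdots\wedge\frac{dz_n}{z_n}-(-1)^n\,2\pi i\,R_{n-1}(z_2,\dots,z_n)\cdot\delta_{T_{z_1}},\qquad R_1=\log(z_1),$$ where $\log$ is the principal branch, $\delta_{T_z}$ is the current with $d[\log z]=\frac{dz}{z}-2\pi i\,\delta_{T_z}$, and orientations are such that the cuts are oriented from $\infty$ to $0$. Let $AJ(Z)$ be the class of $\mathscr{R}(Z)$ in $\mathbb{C}/(2\pi i)^r\mathbb{Z}$ and $\tau(Z)=|(2\pi i)^{-r}\mathscr{R}(Z)|$. Let $\mathrm{Li}_r(z)=\sum_{n\ge1}z^n/n^r$ for $|z|\le 1$ (with $z\ne1$ if $r=1$), and let $B_r$ be the $r$-th Bernoulli polynomial. **Statement.** Suppose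 that there are closed precycles $Z^r_{\ell,a}\in N^r_{\mathbb{R}}(\mathbb{Q}(\zeta_\ell),2r-1)$, $a\in\mathbb{Z}/\ell\mathbb{Z}$, with $$AJ(Z^r_{\ell,a})\equiv(r-1)!\,\ell^{r-1}\,\mathrm{Li}_r(\zeta_\ell^a)\pmod{(2\pi i)^r\mathbb{Z}}\qquad(*)$$ for all $a$ (for all $a\neq 0$ if $r=1$). Let $f:\mathbb{Z}/\ell\mathbb{Z}\to\mathbb{Z}$ satisfy $f(-a)=(-1)^rf(a)$ for all $a$, and put $$Z=\sum_{a=0}^{\ell-1}f(a)\,Z^r_{\ell,a},\qquad q=\frac{\ell^{r-1}}{2r}\sum_{a=0}^{\ell-1}f(a)\,B_r\!\left(\tfrac{a}{\ell}\right)\in\mathbb{Q}.$$ Then $AJ(Z)$ is the class of $-(2\pi i)^r q$ in $\mathbb{C}/(2\pi i)^r\mathbb{Z}$. It is a torsion element, and its order is the denominator of $q$ in lowest terms. If moreover $\mathscr{R}(Z^r_{\ell,a})=(r-1)!\,\ell^{r-1}\mathrm{Li}_r(\zeta_\ell^a)$ as complex numbers for all the $a$ in $(*)$, then $\tau(Z)=|q|$,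 that is, $\tau(Z)=\pm q$. -/

import Mathlib

open MeasureTheory Filter Topology

noncomputable section

namespace HigherChow

/-! ### Algebraic cycles on the algebraic cube

`□ⁿ = (ℙ¹ ∖ {1})ⁿ` over a field `k` is the affine space with coordinate ring
`MvPolynomial (Fin n) k`, where the variable `Xᵢ` is the coordinate `xᵢ = zᵢ / (zᵢ - 1)`; inversely
`zᵢ = xᵢ / (xᵢ - 1)`. Thus `zᵢ = 0` is `xᵢ = 0`, and `zᵢ = ∞` is `xᵢ = 1`. -/

section Cycles

variable (k : Type*) [Field k]

/-- The points of the scheme `□ⁿ`, that is, its irreducible closed subvarieties. -/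
abbrev Subvariety (n : ℕ) : Type _ := PrimeSpectrum (MvPolynomial (Fin n) k)

/-- Algebraic cycles (of mixed codimension) on `□ⁿ`. -/
abbrev Cycle (n : ℕ) : Type _ := Subvariety k n →₀ ℤ

variable {k}

/-- The value of `x = z / (z - 1)` at `z = 0` (for `false`) and at `z = ∞` (for `true`). -/
def facetValue : Bool → k
  | false => 0
  | true => 1

/-- The ideal of a face of `□ⁿ`. The face is given by `σ`: the coordinate `zᵢ` is free if
`σ i = none`, it is `0` if `σ i = some false`, and `∞` if `σ i = some true`. -/
def faceIdeal {n : ℕ} (σ : Fin n → Option Bool) : Ideal (MvPolynomial (Fin n) k) :=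
  Ideal.span {f | ∃ i b, σ i = some b ∧ f = MvPolynomial.X i - MvPolynomial.C (facetValue b)}

/-- The codimension of a face. -/
def faceCodim {n : ℕ} (σ : Fin n → Option Bool) : ℕ :=
  (Finset.univ.filter fun i => σ i ≠ none).card

/-- `V` is a subvariety of `□ⁿ` of codimension `p` that meets every face properly (`V ∩ F` is empty,
or all its components have codimension at least `p + codim F`; the height of the unit ideal
is `⊤`). -/
def IsAdmissible {n : ℕ} (p : ℕ) (V : Subvariety k n) : Prop :=
  V.asIdeal.height = p ∧
    ∀ σ : Fin n → Option Bool, ((p + faceCodim σ : ℕ) : ℕ∞) ≤ (V.asIdeal ⊔ faceIdeal σ).height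

/-- `V` is constant in the coordinate `zᵢ`: its equations can be chosen not to involve `zᵢ`, that
is, `V` is the preimage of a subvariety under the projection that forgets `zᵢ`. -/
def IsConstantIn {n : ℕ} (i : Fin n) (V : Subvariety k n) : Prop :=
  ∃ S : Set (MvPolynomial (Fin n) k), (∀ f ∈ S, i ∉ f.vars) ∧ V.asIdeal = Ideal.span S

/-- The group of cycles all of whose components belong to `S`. -/
def cyclesSupportedOn {n : ℕ} (S : Set (Subvariety k n)) : AddSubgroup (Cycle k n) :=
  (Finsupp.supported ℤ ℤ S).toAddSubgroup

variable (k)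

/-- `cᵖ(k, n)`: the cycles of codimension `p` on `□ⁿ` that meet all faces properly. -/
def admissibleCycles (p n : ℕ) : AddSubgroup (Cycle k n) :=
  cyclesSupportedOn {V | IsAdmissible p V}

/-- `dᵖ(k, n)`: the cycles in `cᵖ(k, n)` all of whose components are constant in some
coordinate. -/
def degenerateCycles (p n : ℕ) : AddSubgroup (Cycle k n) :=
  cyclesSupportedOn {V | IsAdmissible p V ∧ ∃ i, IsConstantIn i V}

/-- The group of precycles `Zᵖ(k, n) = cᵖ(k, n) / dᵖ(k, n)`. -/
abbrev Precycle (p n : ℕ) : Type _ :=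
  admissibleCycles k p n ⧸ (degenerateCycles k p n).addSubgroupOf (admissibleCycles k p n)

/-- The classes in `Zᵖ(k, n)` of those elements of `cᵖ(k, n)` that lie in `A`. -/
def classesOf (p n : ℕ) (A : AddSubgroup (Cycle k n)) : AddSubgroup (Precycle k p n) :=
  (A.addSubgroupOf (admissibleCycles k p n)).map
    (QuotientAddGroup.mk' ((degenerateCycles k p n).addSubgroupOf (admissibleCycles k p n)))

variable {k}

/-- Restriction of functions from `□ⁿ⁺¹` to the facet `zᵢ = 0` or `zᵢ = ∞`, identified with
`□ⁿ` by leaving out the `i`-th coordinate. -/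
def facetRestriction {n : ℕ} (i : Fin (n + 1)) (b : Bool) :
    MvPolynomial (Fin (n + 1)) k →ₐ[k] MvPolynomial (Fin n) k :=
  MvPolynomial.aeval
    (Fin.insertNth (α := fun _ => MvPolynomial (Fin n) k) i (MvPolynomial.C (facetValue b))
      MvPolynomial.X)

/-- The intersection cycle `V · {zᵢ = 0}` or `V · {zᵢ = ∞}` on `□ⁿ` of a subvariety `V` of `□ⁿ⁺¹`.
A component `W` of the intersection has as its multiplicity the length of the local ring at `W` of
the scheme-theoretic intersection, which is the order at `W` of the equation of the facet on `V`. -/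
def facetOfSubvariety {n : ℕ} (i : Fin (n + 1)) (b : Bool) (V : Subvariety k (n + 1)) :
    Cycle k n :=
  let I : Ideal (MvPolynomial (Fin n) k) := V.asIdeal.map (facetRestriction i b)
  ∑ᶠ W : {W : Subvariety k n // W.asIdeal ∈ I.minimalPrimes},
    Finsupp.single W.1
      ((Module.length (Localization.AtPrime W.1.asIdeal)
        (Localization.AtPrime W.1.asIdeal ⧸
          I.map (algebraMap (MvPolynomial (Fin n) k) (Localization.AtPrime W.1.asIdeal)))).toNat : ℤ)

/-- The homomorphism `Z ↦ Z · {zᵢ = 0}` (for `b = false`) or `Z ↦ Z · {zᵢ = ∞}` (for `b = true`). -/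
def facet {n : ℕ} (i : Fin (n + 1)) (b : Bool) : Cycle k (n + 1) →+ Cycle k n :=
  Finsupp.liftAddHom fun V => zmultiplesHom (Cycle k n) (facetOfSubvariety i b V)

/-- `∂ Z = ∑ᵢ (-1)ⁱ (Z · {zᵢ = ∞} - Z · {zᵢ = 0})`, where `i` runs from `1` to `n + 1` (and is
shifted by one here). -/
def boundary {n : ℕ} : Cycle k (n + 1) →+ Cycle k n :=
  ∑ i : Fin (n + 1), ((-1 : ℤ) ^ (i.val + 1)) • (facet i true - facet i false)

variable (k)

/-- The cycles `Z ∈ cᵖ(k, n + 1)` with `Z · {zᵢ = 0} = Z · {zᵢ = ∞} = 0` for all `i` other than the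
last one. Their classes form the group of normalized precycles `Nᵖ(k, n + 1)`. -/
def normalizedCycles (p n : ℕ) : AddSubgroup (Cycle k (n + 1)) :=
  admissibleCycles k p (n + 1) ⊓
    ⨅ i : Fin n, ((facet i.castSucc false).ker ⊓ (facet i.castSucc true).ker)

/-- The closed precycles in `Nᵖ(k, n + 1)`: the classes of the normalized cycles whose boundary
vanishes in `Zᵖ(k, n)`. -/
def closedNormalizedPrecycles (p n : ℕ) : AddSubgroup (Precycle k p (n + 1)) :=
  classesOf k p (n + 1) (normalizedCycles k p n ⊓ (degenerateCycles k p n).comap boundary)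

end Cycles

/-! ### Complex points and `ℝ`-proper precycles -/

section Analytic

variable {k : Type*} [Field k] [Algebra k ℂ]

/-- The set `V(ℂ)` in the affine coordinates `x`. -/
def complexPoints {n : ℕ} (V : Subvariety k n) : Set (EuclideanSpace ℂ (Fin n)) :=
  {x | ∀ f ∈ V.asIdeal, MvPolynomial.aeval (fun i => x i) f = 0}

/-- The coordinate `zᵢ = xᵢ / (xᵢ - 1)` (where it is finite). -/
def zCoord {n : ℕ} (i : Fin n) (x : EuclideanSpace ℂ (Fin n)) : ℂ := x i / (x i - 1)

/-- The cut `T_{zᵢ} = {zᵢ ∈ ℝ_{<0}}`. -/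
def cut {n : ℕ} (i : Fin n) : Set (EuclideanSpace ℂ (Fin n)) :=
  {x | (zCoord i x).re < 0 ∧ (zCoord i x).im = 0}

/-- The complex points of a face. -/
def facePoints {n : ℕ} (σ : Fin n → Option Bool) : Set (EuclideanSpace ℂ (Fin n)) :=
  {x | ∀ i b, σ i = some b → x i = facetValue b}

/-- The analytic set of a subvariety `V` of codimension `p` in `□ⁿ` properly intersects the cuts and
the faces: for each face `F` and each initial segment `I` of the coordinates that are free on `F`,
the set `V(ℂ) ∩ F ∩ ⋂_{i ∈ I} T_{zᵢ}` is empty or has real dimension at most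
`2 (n - p) - 2 codim F - |I|`. (The set is semialgebraic, and so its Hausdorff dimension is its
dimension.) -/
def IsRProper {n : ℕ} (p : ℕ) (V : Subvariety k n) : Prop :=
  ∀ (σ : Fin n → Option Bool) (m : ℕ),
    let I : Finset (Fin n) := Finset.univ.filter fun i => σ i = none ∧ i.val < m
    let S : Set (EuclideanSpace ℂ (Fin n)) := complexPoints V ∩ facePoints σ ∩ ⋂ i ∈ I, cut i
    S = ∅ ∨ dimH S + ((2 * p + 2 * faceCodim σ + I.card : ℕ) : ENNReal) ≤ ((2 * n : ℕ) : ENNReal)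

variable (k)

/-- The `ℝ`-proper precycles `Zᵖ_ℝ(k, n)` in `Zᵖ(k, n)`. -/
def rProperPrecycles (p n : ℕ) : AddSubgroup (Precycle k p n) :=
  classesOf k p n (cyclesSupportedOn {V | IsAdmissible p V ∧ IsRProper p V})

/-- The closed precycles in `Nᵖ_ℝ(k, n + 1) = Nᵖ(k, n + 1) ∩ Zᵖ_ℝ(k, n + 1)`. -/
def closedNR (p n : ℕ) : AddSubgroup (Precycle k p (n + 1)) :=
  closedNormalizedPrecycles k p n ⊓ rProperPrecycles k p (n + 1)

/-! ### The current `R_n` and its integral -/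

variable {k}

/-- The (Zariski) tangent space of `V(ℂ)` at `x`. -/
def tangentSpace {n : ℕ} (V : Subvariety k n) (x : EuclideanSpace ℂ (Fin n)) :
    Submodule ℂ (EuclideanSpace ℂ (Fin n)) where
  carrier := {v | ∀ f ∈ V.asIdeal,
    ∑ i, MvPolynomial.aeval (fun i => x i) (MvPolynomial.pderiv i f) * v i = 0}
  zero_mem' := fun f _ => by simp
  add_mem' := fun {v w} hv hw f hf => by
    simp only [PiLp.add_apply, mul_add, Finset.sum_add_distrib, hv f hf, hw f hf, add_zero]
  smul_mem' := fun c v hv f hf => by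
    simp only [PiLp.smul_apply, smul_eq_mul, mul_left_comm _ c, ← Finset.mul_sum, hv f hf,
      mul_zero]

/-- The smooth points of `V(ℂ)`, for `V` of dimension `d`. -/
def smoothPoints {n : ℕ} (d : ℕ) (V : Subvariety k n) : Set (EuclideanSpace ℂ (Fin n)) :=
  {x | x ∈ complexPoints V ∧ Module.finrank ℂ (tangentSpace V x) = d}

/-- The positively oriented real orthonormal frame `e₁, i e₁, …, e_d, i e_d` of the tangent space at
a smooth point, for a unitary basis `e₁, …, e_d`. -/
def frame {n : ℕ} (d : ℕ) (V : Subvariety k n) (x : EuclideanSpace ℂ (Fin n)) (b : Fin d × Fin 2) :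
    EuclideanSpace ℂ (Fin n) :=
  if h : b.1.val < Module.finrank ℂ (tangentSpace V x) then
    (Complex.I ^ b.2.val) • (stdOrthonormalBasis ℂ (tangentSpace V x) ⟨b.1.val, h⟩ :
      EuclideanSpace ℂ (Fin n))
  else 0

/-- The value at the point `x` and the tangent vector `v` of the form
`dzᵢ / zᵢ = dxᵢ / xᵢ - dxᵢ / (xᵢ - 1)`. -/
def dlog {n : ℕ} (i : Fin n) (x v : EuclideanSpace ℂ (Fin n)) : ℂ :=
  v i / x i - v i / (x i - 1)

/-- The value at `x` and `v` of the `a`-th factor of the form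
`d arg z₀ ∧ ⋯ ∧ d arg z_{j-1} ∧ dlog z_{j+1} ∧ ⋯ ∧ dlog z_n` on `□ⁿ⁺¹` (coordinates are
counted from `0`). -/
def formFactor {n : ℕ} (j : Fin (n + 1)) (a : Fin n) (x v : EuclideanSpace ℂ (Fin (n + 1))) : ℂ :=
  if j.succAbove a < j then ((dlog (j.succAbove a) x v).im : ℂ) else dlog (j.succAbove a) x v

/-- The value at a smooth point `x` of
`log(z_j) · (d arg z₀ ∧ ⋯ ∧ d arg z_{j-1} ∧ dlog z_{j+1} ∧ ⋯ ∧ dlog z_{2d})`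
on the oriented orthonormal frame of `V`. -/
def integrand (d : ℕ) (V : Subvariety k (d * 2 + 1)) (j : Fin (d * 2 + 1))
    (x : EuclideanSpace ℂ (Fin (d * 2 + 1))) : ℂ :=
  Complex.log (zCoord j x) *
    Matrix.det (Matrix.of fun b c : Fin d × Fin 2 =>
      formFactor j (finProdFinEquiv b) x (frame d V x c))

/-- The points of `V` where `|arg(-zᵢ)| < ρ` for all `i < j`: a neighbourhood of
`T_{z₀} ∩ ⋯ ∩ T_{z_{j-1}}`. -/
def sector (d : ℕ) (V : Subvariety k (d * 2 + 1)) (j : Fin (d * 2 + 1)) (ρ : ℝ) :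
    Set (EuclideanSpace ℂ (Fin (d * 2 + 1))) :=
  {x | x ∈ smoothPoints d V ∧ ∀ i < j, |(-zCoord i x).arg| < ρ}

/-- `∫_V δ_{T_{z₀}} ∧ ⋯ ∧ δ_{T_{z_{j-1}}} ∧ log(z_j) dlog z_{j+1} ∧ ⋯ ∧ dlog z_{2d}` for `V` of
dimension `d` in `□^{2d+1}`, where `δ_{T_z}` is the current determined by
`d[log z] = dlog z - 2πi δ_{T_z}`. This current is the limit for `ρ → 0` of the forms
`(2ρ)⁻¹ 1_{|arg(-z)| < ρ} d arg z`, and accordingly the product of the currents is the limit of the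
products of these forms, which counts the components of the intersection of the cuts with their
intersection multiplicities. -/
def regulatorTerm (d : ℕ) (V : Subvariety k (d * 2 + 1)) (j : Fin (d * 2 + 1)) : ℂ :=
  limUnder (𝓝[>] (0 : ℝ)) fun ρ : ℝ =>
    ((2 * ρ : ℝ) : ℂ)⁻¹ ^ j.val * ∫ x in sector d V j ρ, integrand d V j x ∂μHE[d * 2]

/-- `(2πi)^{-d} ∫_V R_{2d+1}` for a subvariety `V` of dimension `d` in `□^{2d+1}`.
The recursion `R_n = log(z₁) dlog z₂ ∧ ⋯ ∧ dlog z_n - (-1)ⁿ 2πi R_{n-1} ∧ δ_{T_{z₁}}`, with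
`R_{n-1}` in the variables `z₂, …, z_n`, has been unfolded to
`R_n = ∑_j (-2πi)^j δ_{T_{z₁}} ∧ ⋯ ∧ δ_{T_{z_j}} ∧ log(z_{j+1}) dlog z_{j+2} ∧ ⋯ ∧ dlog z_n`.
The leading sign is the orientation convention for which the term with `j = d` is
`(2πi)^d` times the integral of `log(z_{d+1}) dlog z_{d+2} ∧ ⋯` over `V ∩ T_{z₁} ∩ ⋯ ∩ T_{z_d}`
with each cut oriented from `∞` to `0`. -/
def regulatorOfSubvariety (d : ℕ) (V : Subvariety k (d * 2 + 1)) : ℂ :=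
  (-1) ^ ((d + 1) * d / 2) * ((2 * Real.pi * Complex.I) ^ d)⁻¹ *
    ∑ j : Fin (d * 2 + 1), (-(2 * Real.pi * Complex.I)) ^ j.val * regulatorTerm d V j

/-- `Z ↦ (2πi)^{-d} ∫_Z R_{2d+1}` on cycles. -/
def regulatorOfCycle (d : ℕ) : Cycle k (d * 2 + 1) →+ ℂ :=
  Finsupp.liftAddHom fun V => zmultiplesHom ℂ (regulatorOfSubvariety d V)

/-! The regulator vanishes on degenerate cycles. -/

theorem single_mem_tangentSpace {n : ℕ} {V : Subvariety k n} {i : Fin n} (hV : IsConstantIn i V)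
    {x : EuclideanSpace ℂ (Fin n)} (hx : x ∈ complexPoints V) :
    EuclideanSpace.single i (1 : ℂ) ∈ tangentSpace V x := by
  obtain ⟨S, hS, hVS⟩ := hV
  have key : ∀ f ∈ V.asIdeal,
      MvPolynomial.aeval (fun i => x i) (MvPolynomial.pderiv i f) = 0 := by
    intro f hf
    have hx' : ∀ g ∈ Ideal.span S, MvPolynomial.aeval (fun i => x i) g = 0 := by
      intro g hg
      exact hx g (hVS ▸ hg)
    rw [hVS] at hf
    refine Submodule.span_induction (p := fun f _ =>
      MvPolynomial.aeval (fun i => x i) (MvPolynomial.pderiv i f) = 0) ?_ ?_ ?_ ?_ hf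
    · intro f hf
      rw [MvPolynomial.pderiv_eq_zero_of_notMem_vars (hS f hf), map_zero]
    · simp
    · intro f g _ _ hf hg
      simp [hf, hg]
    · intro a f hf h
      simp [Derivation.leibniz, h, hx' f hf]
  intro f hf
  rw [Finset.sum_eq_single i]
  · simp [key f hf]
  · intro b _ hb
    simp [hb]
  · simp

theorem formFactor_sum {n d : ℕ} (j : Fin (n + 1)) (a : Fin n)
    (x : EuclideanSpace ℂ (Fin (n + 1))) (v : Fin d × Fin 2 → EuclideanSpace ℂ (Fin (n + 1)))
    (c : Fin d × Fin 2 → ℝ) :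
    formFactor j a x (∑ b, (c b : ℂ) • v b) = ∑ b, formFactor j a x (v b) * (c b : ℂ) := by
  have h : ∀ i, dlog i x (∑ b, (c b : ℂ) • v b) = ∑ b, dlog i x (v b) * (c b : ℂ) := by
    intro i
    simp only [dlog, WithLp.ofLp_sum, Finset.sum_apply, PiLp.smul_apply, smul_eq_mul,
      Finset.sum_div, ← Finset.sum_sub_distrib]
    refine Finset.sum_congr rfl fun b _ => ?_
    ring
  unfold formFactor
  split_ifs
  · rw [h]
    simp
  · exact h _

theorem integrand_eq_zero (d : ℕ) {V : Subvariety k (d * 2 + 1)} {i : Fin (d * 2 + 1)}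
    (hV : IsConstantIn i V) (j : Fin (d * 2 + 1)) {x : EuclideanSpace ℂ (Fin (d * 2 + 1))}
    (hx : x ∈ smoothPoints d V) : integrand d V j x = 0 := by
  obtain ⟨hx, hd⟩ := hx
  set e : EuclideanSpace ℂ (Fin (d * 2 + 1)) := EuclideanSpace.single i (1 : ℂ) with he
  have heT : e ∈ tangentSpace V x := single_mem_tangentSpace hV hx
  let u := stdOrthonormalBasis ℂ (tangentSpace V x)
  let q : Fin d → ℂ := fun l => u.repr ⟨e, heT⟩ (Fin.cast hd.symm l)
  have hsum : ∑ l : Fin d, q l • (u (Fin.cast hd.symm l) : EuclideanSpace ℂ (Fin (d * 2 + 1)))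
      = e := by
    have h1 := congrArg (Subtype.val) (u.sum_repr ⟨e, heT⟩)
    rw [Submodule.coe_sum] at h1
    refine Eq.trans ?_ h1
    exact Fintype.sum_equiv (finCongr hd.symm) _ _ (fun l => rfl)
  have hfr : ∀ b : Fin d × Fin 2, frame d V x b = (Complex.I ^ b.2.val) •
      (u (Fin.cast hd.symm b.1) : EuclideanSpace ℂ (Fin (d * 2 + 1))) := by
    intro b
    unfold frame
    rw [dif_pos (hd.symm ▸ b.1.isLt)]
    rfl
  obtain ⟨l, hl⟩ : ∃ l, q l ≠ 0 := by
    by_contra! h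
    have : e = 0 := by rw [← hsum]; simp [h]
    have h2 := congrArg (fun v : EuclideanSpace ℂ (Fin (d * 2 + 1)) => v i) this
    simp [he] at h2
  let c : Fin d × Fin 2 → ℝ := fun b => if b.2 = 0 then (q b.1).re else (q b.1).im
  let c' : Fin d × Fin 2 → ℝ := fun b => if b.2 = 0 then -(q b.1).im else (q b.1).re
  have hc : ∑ b, (c b : ℂ) • frame d V x b = e := by
    rw [← hsum, Fintype.sum_prod_type]
    refine Finset.sum_congr rfl fun m _ => ?_
    rw [Fin.sum_univ_two, hfr, hfr, smul_smul, smul_smul, ← add_smul]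
    congr 1
    simp [c, Complex.re_add_im]
  have hc' : ∑ b, (c' b : ℂ) • frame d V x b = Complex.I • e := by
    rw [← hsum, Fintype.sum_prod_type, Finset.smul_sum]
    refine Finset.sum_congr rfl fun m _ => ?_
    rw [Fin.sum_univ_two, hfr, hfr, smul_smul, smul_smul, smul_smul, ← add_smul]
    congr 1
    apply Complex.ext <;> simp [c']
  have hzero : ∀ a : Fin (d * 2), j.succAbove a ≠ i → ∀ s : ℂ, formFactor j a x (s • e) = 0 := by
    intro a ha s
    simp [formFactor, dlog, he, ha]
  have hdet : Matrix.det (Matrix.of fun b c : Fin d × Fin 2 =>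
      formFactor j (finProdFinEquiv b) x (frame d V x c)) = 0 := by
    rw [← Matrix.exists_mulVec_eq_zero_iff]
    have hmul : ∀ (c : Fin d × Fin 2 → ℝ) (a : Fin d × Fin 2),
        ∑ b, formFactor j (finProdFinEquiv a) x (frame d V x b) * (c b : ℂ) =
          formFactor j (finProdFinEquiv a) x (∑ b, (c b : ℂ) • frame d V x b) :=
      fun c a => (formFactor_sum _ _ _ _ _).symm
    have hcne : ∀ α β : ℂ, (∀ b, α * (c b : ℂ) + β * (c' b : ℂ) = 0) → α = 0 ∧ β = 0 := by
      intro α β h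
      have h0 := h (l, 0)
      have h1 := h (l, 1)
      simp only [c, c', if_true, if_neg (show (1 : Fin 2) ≠ 0 by decide)] at h0 h1
      push_cast at h0 h1
      have hn : (((q l).re : ℂ) ^ 2 + ((q l).im : ℂ) ^ 2) ≠ 0 := by
        have : Complex.normSq (q l) ≠ 0 := by simpa using hl
        rw [Complex.normSq_apply] at this
        intro h
        apply this
        have h3 : (((q l).re * (q l).re + (q l).im * (q l).im : ℝ) : ℂ) = 0 := by
          push_cast
          rw [← h]
          ring
        exact_mod_cast h3
      constructor
      · refine (mul_eq_zero.mp (?_ : α * _ = 0)).resolve_right hn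
        linear_combination ((q l).re : ℂ) * h0 + ((q l).im : ℂ) * h1
      · refine (mul_eq_zero.mp (?_ : β * _ = 0)).resolve_right hn
        linear_combination (-((q l).im : ℂ)) * h0 + ((q l).re : ℂ) * h1
    have hcomb : ∃ α β : ℂ, ¬ (α = 0 ∧ β = 0) ∧ ∀ a : Fin d × Fin 2,
        α * formFactor j (finProdFinEquiv a) x e +
          β * formFactor j (finProdFinEquiv a) x (Complex.I • e) = 0 := by
      have hz1 : ∀ a : Fin (d * 2), j.succAbove a ≠ i → formFactor j a x e = 0 := by
        intro a ha
        simpa using hzero a ha 1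
      by_cases hi : ∃ a₀, j.succAbove a₀ = i
      · obtain ⟨a₀, ha₀⟩ := hi
        have hother : ∀ a : Fin (d * 2), a ≠ a₀ → j.succAbove a ≠ i := by
          intro a ha h
          exact ha (Fin.succAbove_right_injective (h.trans ha₀.symm))
        by_cases h0 : formFactor j a₀ x e = 0
        · refine ⟨1, 0, by simp, fun a => ?_⟩
          by_cases ha : finProdFinEquiv a = a₀
          · simp [ha, h0]
          · simp [hz1 _ (hother _ ha)]
        · refine ⟨formFactor j a₀ x (Complex.I • e), -formFactor j a₀ x e,
            fun h => h0 (neg_eq_zero.mp h.2), fun a => ?_⟩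
          by_cases ha : finProdFinEquiv a = a₀
          · rw [ha]
            ring
          · rw [hz1 _ (hother _ ha), hzero _ (hother _ ha)]
            ring
      · refine ⟨1, 0, by simp, fun a => ?_⟩
        rw [hz1 _ (fun h => hi ⟨_, h⟩)]
        simp
    obtain ⟨α, β, hαβ, hab⟩ := hcomb
    refine ⟨fun b => α * (c b : ℂ) + β * (c' b : ℂ), fun h => hαβ (hcne α β (congrFun h)), ?_⟩
    funext a
    have h1 := hmul c a
    have h2 := hmul c' a
    rw [hc] at h1
    rw [hc'] at h2
    simp only [Matrix.mulVec, dotProduct, Matrix.of_apply, Pi.zero_apply]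
    rw [← hab a, ← h1, ← h2, Finset.mul_sum, Finset.mul_sum, ← Finset.sum_add_distrib]
    refine Finset.sum_congr rfl fun b _ => ?_
    ring
  simp [integrand, hdet]

theorem regulatorOfSubvariety_eq_zero (d : ℕ) {V : Subvariety k (d * 2 + 1)}
    {i : Fin (d * 2 + 1)} (hV : IsConstantIn i V) :
    regulatorOfSubvariety d V = 0 := by
  have h : ∀ j, regulatorTerm d V j = 0 := by
    intro j
    unfold regulatorTerm
    have h0 : ∀ ρ : ℝ, ((2 * ρ : ℝ) : ℂ)⁻¹ ^ j.val *
        ∫ x in sector d V j ρ, integrand d V j x ∂μHE[d * 2] = 0 := by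
      intro ρ
      rw [setIntegral_eq_zero_of_forall_eq_zero, mul_zero]
      exact fun x hx => integrand_eq_zero d hV j hx.1
    simp only [h0]
    exact tendsto_const_nhds.limUnder_eq
  simp [regulatorOfSubvariety, h]

/-- `Z ↦ (2πi)^{-d} ∫_Z R_{2d+1}` on the group `Zᵖ(k, 2d+1)`. -/
def regulator (d p : ℕ) : Precycle k p (d * 2 + 1) →+ ℂ :=
  QuotientAddGroup.lift _
    ((regulatorOfCycle d).comp (admissibleCycles k p (d * 2 + 1)).subtype) fun z hz => by
      have hz' : z.1 ∈ degenerateCycles k p (d * 2 + 1) := AddSubgroup.mem_addSubgroupOf.mp hz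
      have hsupp : ∀ V ∈ z.1.support, ∃ i, IsConstantIn i V := fun V hV => (hz' hV).2
      change regulatorOfCycle d z.1 = 0
      rw [regulatorOfCycle, Finsupp.liftAddHom_apply]
      refine Finset.sum_eq_zero fun V hV => ?_
      obtain ⟨i, hi⟩ := hsupp V hV
      simp [regulatorOfSubvariety_eq_zero d hi]

variable (k)

/-- The complex number `ℛ(Z) = (2πi)^{-(r-1)} ∫_Z R_{2r-1}` for a closed precycle
`Z ∈ Nʳ_ℝ(k, 2r - 1)`. -/
def regulatorNR (r : ℕ) : closedNR k r ((r - 1) * 2) →+ ℂ :=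
  (regulator (r - 1) r).comp (closedNR k r ((r - 1) * 2)).subtype

/-- The Abel–Jacobi map `Z ↦ ℛ(Z) ∈ ℂ / (2πi)ʳ ℤ` on the closed precycles in `Nʳ_ℝ(k, 2r - 1)`. -/
def AJ (r : ℕ) : closedNR k r ((r - 1) * 2) →+
    ℂ ⧸ AddSubgroup.zmultiples ((2 * Real.pi * Complex.I : ℂ) ^ r) :=
  (QuotientAddGroup.mk' _).comp (regulatorNR k r)

variable {k}

/-- `τ(Z) = |(2πi)^{-r} ℛ(Z)|`. -/
def tau (r : ℕ) (Z : closedNR k r ((r - 1) * 2)) : ℝ :=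
  ‖((2 * Real.pi * Complex.I : ℂ) ^ r)⁻¹ * regulatorNR k r Z‖

end Analytic

/-- The root of unity `ζ_ℓ = exp(2πi/ℓ)`. -/
def zeta (ℓ : ℕ) : ℂ := Complex.exp (2 * Real.pi * Complex.I / ℓ)

/-- The cyclotomic field `ℚ(ζ_ℓ)` as a subfield of `ℂ`. -/
abbrev CyclotomicSubfield (ℓ : ℕ) : IntermediateField ℚ ℂ := IntermediateField.adjoin ℚ {zeta ℓ}

/-- The polylogarithm `Li_r(z) = ∑_{n ≥ 1} zⁿ / nʳ` for `|z| ≤ 1`; if `r = 1`, then it is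
`-log(1 - z)` for `z ≠ 1` (where on the unit circle the series converges only conditionally). -/
def polylog (r : ℕ) (z : ℂ) : ℂ :=
  if r = 1 then -Complex.log (1 - z) else ∑' n : ℕ, z ^ (n + 1) / ((n : ℂ) + 1) ^ r

/-- `(r - 1)! ℓ^{r-1} Li_r(ζ_ℓ^a)`. -/
def polylogValue (r ℓ : ℕ) (a : ZMod ℓ) : ℂ :=
  ((r - 1).factorial : ℂ) * (ℓ : ℂ) ^ (r - 1) * polylog r (zeta ℓ ^ a.val)

/-- `(ℓ^{r-1} / 2r) ∑_a f(a) B_r(a/ℓ)`, where `a` runs through `0, …, ℓ - 1`. -/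
def bernoulliSum (r ℓ : ℕ) [NeZero ℓ] (f : ZMod ℓ → ℤ) : ℚ :=
  (ℓ : ℚ) ^ (r - 1) / (2 * r) *
    ∑ a : ZMod ℓ, (f a : ℚ) * (Polynomial.bernoulli r).eval ((a.val : ℚ) / ℓ)

end HigherChow

end

namespace HigherChow

/-! The cycles enter only through the additivity of `AJ` and `regulatorNR`, so everything reduces to
evaluating `∑ f(a) (r-1)! ℓ^{r-1} Li_r(ζ^a)`. On the unit circle `Li_r(z) + (-1)^r Li_r(1/z)` is, up
to a constant, the Fourier series of the Bernoulli polynomial `B_r` (`polylog_add_polylog_inv`). The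
parity of `f` allows the sum to be averaged with its image under `a ↦ -a`, which produces exactly
this combination and hence the value `-(2πi)^r q` (`sum_mul_polylogValue`). The order is then
elementary: `n` kills the class of `-c q` in `ℂ / cℤ` iff `n q` is an integer, that is, iff the
denominator of `q` divides `n` (`addOrderOf_mk_neg_mul_ratCast`). -/

/-! ### Polylogarithms on the unit circle -/

theorem log_one_sub_exp {x : ℝ} (h0 : 0 < x) (h1 : x < 1) :
    Complex.log (1 - Complex.exp (2 * Real.pi * Complex.I * x)) =
      Real.log (2 * Real.sin (Real.pi * x)) +
        ((Real.pi * x - Real.pi / 2 : ℝ) : ℂ) * Complex.I := by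
  have hpi := Real.pi_pos
  have hs : 0 < 2 * Real.sin (Real.pi * x) := by
    have := Real.sin_pos_of_pos_of_lt_pi (mul_pos hpi h0) (by nlinarith)
    linarith
  -- Polar form by the half-angle formulas. The modulus is positive and the angle lies in `(-π/2,
  -- π/2)`, so the principal logarithm can be read off.
  have key : 1 - Complex.exp (2 * Real.pi * Complex.I * x) =
      ((2 * Real.sin (Real.pi * x) : ℝ) : ℂ) *
        Complex.exp (((Real.pi * x - Real.pi / 2 : ℝ) : ℂ) * Complex.I) := by
    have e1 : Complex.exp (2 * Real.pi * Complex.I * x) =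
        Complex.exp (((Real.pi * x : ℝ) : ℂ) * Complex.I) ^ 2 := by
      rw [← Complex.exp_nat_mul]
      congr 1
      push_cast
      ring
    rw [e1, Complex.exp_mul_I, Complex.exp_mul_I, ← Complex.ofReal_cos, ← Complex.ofReal_sin,
      ← Complex.ofReal_cos, ← Complex.ofReal_sin, Real.cos_sub_pi_div_two, Real.sin_sub_pi_div_two]
    have h := Real.sin_sq_add_cos_sq (Real.pi * x)
    have h' : ((Real.sin (Real.pi * x) : ℂ)) ^ 2 + (Real.cos (Real.pi * x) : ℂ) ^ 2 = 1 := by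
      exact_mod_cast h
    push_cast at h' ⊢
    linear_combination -h' - Complex.sin (Real.pi * x) ^ 2 * Complex.I_sq
  rw [key, Complex.log_ofReal_mul hs (Complex.exp_ne_zero _), Complex.log_exp]
  · simp only [Complex.mul_I_im, Complex.ofReal_re]
    nlinarith
  · simp only [Complex.mul_I_im, Complex.ofReal_re]
    nlinarith

theorem norm_exp_two_pi_I_mul (x : ℝ) : ‖Complex.exp (2 * Real.pi * Complex.I * x)‖ = 1 := by
  have h : (2 * Real.pi * Complex.I * x : ℂ) = ((2 * Real.pi * x : ℝ) : ℂ) * Complex.I := by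
    push_cast
    ring
  rw [h, Complex.norm_exp_ofReal_mul_I]

theorem hasSum_polylog {r : ℕ} (hr : 2 ≤ r) {z : ℂ} (hz : ‖z‖ ≤ 1) :
    HasSum (fun n : ℕ => z ^ n / (n : ℂ) ^ r) (polylog r z) := by
  have hs : Summable fun n : ℕ => z ^ n / (n : ℂ) ^ r := by
    refine Summable.of_norm_bounded (Real.summable_one_div_nat_pow.mpr hr) fun n => ?_
    rw [norm_div, norm_pow, norm_pow, Complex.norm_natCast]
    gcongr
    exact pow_le_one₀ (norm_nonneg _) hz
  have h := hs.hasSum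
  rw [hs.tsum_eq_zero_add] at h
  -- The added term at `n = 0` is `1 / 0 ^ r`, which is `0` because `r ≠ 0`.
  have h0 : r ≠ 0 := by omega
  simpa [polylog, show r ≠ 1 by omega, h0] using h

/-- The inversion formula for polylogarithms on the unit circle. -/
theorem polylog_add_polylog_inv {r : ℕ} (hr : 1 ≤ r) {x : ℝ} (h0 : 0 ≤ x) (h1 : x < 1)
    (hx : r = 1 → x ≠ 0) :
    polylog r (Complex.exp (2 * Real.pi * Complex.I * x)) +
        (-1) ^ r * polylog r (Complex.exp (2 * Real.pi * Complex.I * x))⁻¹ =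
      -(2 * Real.pi * Complex.I) ^ r / r.factorial * bernoulliFun r x := by
  rcases hr.eq_or_lt with rfl | hr
  · have h0 : 0 < x := lt_of_le_of_ne h0 (hx rfl).symm
    have hinv : (Complex.exp (2 * Real.pi * Complex.I * x))⁻¹ =
        Complex.exp (2 * Real.pi * Complex.I * ((1 - x : ℝ) : ℂ)) := by
      rw [← Complex.exp_neg]
      push_cast
      rw [mul_sub, mul_one, sub_eq_add_neg, Complex.exp_add, Complex.exp_two_pi_mul_I, one_mul]
    -- Conjugate points have equal moduli `|1 - z|`, so the real parts of the two logarithms cancel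
    -- and only the linear angle, that is `B_1`, survives.
    have hsin : Real.sin (Real.pi * (1 - x)) = Real.sin (Real.pi * x) := by
      rw [mul_sub, mul_one, Real.sin_pi_sub]
    rw [hinv]
    simp only [polylog, if_true]
    rw [log_one_sub_exp h0 h1, log_one_sub_exp (by linarith) (by linarith), hsin,
      bernoulliFun_one]
    push_cast
    simp
    ring
  · have hz := norm_exp_two_pi_I_mul x
    have hz' : ‖(Complex.exp (2 * Real.pi * Complex.I * x))⁻¹‖ ≤ 1 := by
      rw [norm_inv, hz, inv_one]
    refine ((hasSum_polylog hr hz.le).add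
      ((hasSum_polylog hr hz').mul_left _)).unique ?_
    -- The Fourier expansion of `B_r`, with the frequencies `n` and `-n` paired; what remains is to
    -- match the characters with powers of `z` and `z⁻¹`.
    convert! hasSum_one_div_nat_pow_mul_fourier hr ⟨h0, h1.le⟩ using 2 with n
    rw [fourier_coe_apply, fourier_coe_apply, inv_pow, ← Complex.exp_nat_mul, ← Complex.exp_neg]
    have e1 : (2 * Real.pi * Complex.I * ((n : ℤ) : ℂ) * x / (1 : ℝ) : ℂ) =
        n * (2 * Real.pi * Complex.I * x) := by
      push_cast
      ring
    have e2 : (2 * Real.pi * Complex.I * ((-(n : ℤ) : ℤ) : ℂ) * x / (1 : ℝ) : ℂ) =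
        -(n * (2 * Real.pi * Complex.I * x)) := by
      push_cast
      ring
    rw [e1, e2]
    ring

/-! ### Polylogarithms at roots of unity -/

theorem zeta_pow (ℓ n : ℕ) :
    zeta ℓ ^ n = Complex.exp (2 * Real.pi * Complex.I * ((n / ℓ : ℝ) : ℂ)) := by
  rw [zeta, ← Complex.exp_nat_mul]
  congr 1
  push_cast
  ring

theorem zeta_pow_self (ℓ : ℕ) [NeZero ℓ] : zeta ℓ ^ ℓ = 1 := by
  rw [zeta_pow, div_self (NeZero.ne (ℓ : ℝ)), Complex.ofReal_one, mul_one,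
    Complex.exp_two_pi_mul_I]

theorem zeta_pow_val_neg {ℓ : ℕ} [NeZero ℓ] (a : ZMod ℓ) :
    zeta ℓ ^ (-a).val = (zeta ℓ ^ a.val)⁻¹ := by
  refine eq_inv_of_mul_eq_one_left ?_
  -- Divisibility suffices and covers `a = 0`, where the sum of the representatives is `0` instead
  -- of `ℓ`.
  obtain ⟨m, hm⟩ : ℓ ∣ (-a).val + a.val := by
    rw [← ZMod.natCast_eq_zero_iff]
    simp
  rw [← pow_add, hm, pow_mul, zeta_pow_self, one_pow]

theorem bernoulliFun_ratCast (r : ℕ) (x : ℚ) :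
    bernoulliFun r (x : ℝ) = ((Polynomial.bernoulli r).eval x : ℚ) := by
  rw [bernoulliFun, ← eq_ratCast (algebraMap ℚ ℝ) x, Polynomial.eval_map_algebraMap,
    Polynomial.aeval_algebraMap_apply_eq_algebraMap_eval]
  rfl

/-- The inversion formula at `x = a/ℓ`; the factor `(r-1)!` turns its `1/r!` into `1/r`. The case `r
= 1`, `a = 0` is genuinely excluded: there the left side is `0` since `Complex.log 0 = 0`, while
`B_1(0) ≠ 0`. -/
theorem polylogValue_add_polylogValue_neg {r ℓ : ℕ} (hr : 1 ≤ r) [NeZero ℓ] (a : ZMod ℓ)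
    (ha : r = 1 → a ≠ 0) :
    polylogValue r ℓ a + (-1) ^ r * polylogValue r ℓ (-a) =
      -(2 * Real.pi * Complex.I) ^ r * ((ℓ : ℂ) ^ (r - 1) / r *
        (((Polynomial.bernoulli r).eval ((a.val : ℚ) / ℓ) : ℚ) : ℂ)) := by
  have hℓ : (0 : ℝ) < ℓ := by exact_mod_cast NeZero.pos ℓ
  have h := polylog_add_polylog_inv hr (x := (a.val : ℝ) / ℓ) (by positivity)
    ((div_lt_one hℓ).mpr (by exact_mod_cast a.val_lt)) (fun h => by
      have hv : (a.val : ℝ) ≠ 0 := by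
        exact_mod_cast (ZMod.val_eq_zero a).not.mpr (ha h)
      exact div_ne_zero hv hℓ.ne')
  have hb := bernoulliFun_ratCast r ((a.val : ℚ) / ℓ)
  push_cast at hb
  rw [hb, ← zeta_pow, ← zeta_pow_val_neg, Complex.ofReal_ratCast] at h
  have hfac : (r.factorial : ℂ) = r * (r - 1).factorial := by
    exact_mod_cast (Nat.mul_factorial_pred (by omega)).symm
  have hr0 : (r : ℂ) ≠ 0 := by exact_mod_cast (by omega : r ≠ 0)
  have hf0 : ((r - 1).factorial : ℂ) ≠ 0 := by exact_mod_cast (r - 1).factorial_ne_zero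
  rw [hfac] at h
  calc polylogValue r ℓ a + (-1) ^ r * polylogValue r ℓ (-a)
      = ((r - 1).factorial : ℂ) * (ℓ : ℂ) ^ (r - 1) *
          (polylog r (zeta ℓ ^ a.val) + (-1) ^ r * polylog r (zeta ℓ ^ (-a).val)) := by
        simp only [polylogValue]
        ring
    _ = _ := by
        rw [h]
        field_simp

/-- Reindexing by `a ↦ -a` and adding makes inversion applicable term by term. The doubling accounts
for the `2` in the denominator `2r` of `bernoulliSum`. -/
theorem sum_mul_polylogValue {r ℓ : ℕ} (hr : 1 ≤ r) [NeZero ℓ] (f : ZMod ℓ → ℤ)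
    (hf : ∀ a, f (-a) = (-1) ^ r * f a) :
    ∑ a, (f a : ℂ) * polylogValue r ℓ a =
      -((2 * Real.pi * Complex.I) ^ r * (bernoulliSum r ℓ f : ℂ)) := by
  have hneg : ∑ a, (f a : ℂ) * polylogValue r ℓ a =
      ∑ a, (f a : ℂ) * ((-1) ^ r * polylogValue r ℓ (-a)) := by
    rw [← Equiv.sum_comp (Equiv.neg (ZMod ℓ))]
    refine Finset.sum_congr rfl fun a _ => ?_
    simp only [Equiv.neg_apply, hf]
    push_cast
    ring
  have h2 : 2 * ∑ a, (f a : ℂ) * polylogValue r ℓ a =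
      ∑ a, (f a : ℂ) * (-(2 * Real.pi * Complex.I) ^ r * ((ℓ : ℂ) ^ (r - 1) / r *
        (((Polynomial.bernoulli r).eval ((a.val : ℚ) / ℓ) : ℚ) : ℂ))) := by
    rw [two_mul]
    nth_rw 2 [hneg]
    rw [← Finset.sum_add_distrib]
    refine Finset.sum_congr rfl fun a _ => ?_
    by_cases ha : r = 1 → a ≠ 0
    · rw [← mul_add, polylogValue_add_polylogValue_neg hr a ha]
    -- In the excluded case, `f(0) = -f(0)` makes the term vanish.
    · push Not at ha
      obtain ⟨rfl, rfl⟩ := ha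
      have h0 := hf 0
      have : f 0 = 0 := by
        rw [neg_zero] at h0
        omega
      simp [this]
  have h3 : 2 * ∑ a, (f a : ℂ) * polylogValue r ℓ a =
      2 * -((2 * Real.pi * Complex.I) ^ r * (bernoulliSum r ℓ f : ℂ)) := by
    rw [h2, bernoulliSum]
    push_cast
    simp only [Finset.mul_sum, ← Finset.sum_neg_distrib]
    refine Finset.sum_congr rfl fun a _ => ?_
    ring
  exact mul_left_cancel₀ two_ne_zero h3

/-! ### Orders of torsion classes -/

/-- The order of the class of `-c q` in `ℂ / c ℤ` is the denominator of `q`. -/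
theorem addOrderOf_mk_neg_mul_ratCast {c : ℂ} (hc : c ≠ 0) (q : ℚ) :
    addOrderOf (QuotientAddGroup.mk (-(c * q)) : ℂ ⧸ AddSubgroup.zmultiples c) = q.den := by
  refine Nat.dvd_antisymm ?_ ?_
  · rw [addOrderOf_dvd_iff_nsmul_eq_zero, ← QuotientAddGroup.mk_nsmul,
      QuotientAddGroup.eq_zero_iff, AddSubgroup.mem_zmultiples_iff]
    refine ⟨-q.num, ?_⟩
    have h : (q : ℂ) * q.den = q.num := by exact_mod_cast Rat.mul_den_eq_num q
    simp only [zsmul_eq_mul, nsmul_eq_mul, Int.cast_neg]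
    linear_combination c * h
  · have h := addOrderOf_nsmul_eq_zero
      (QuotientAddGroup.mk (-(c * q)) : ℂ ⧸ AddSubgroup.zmultiples c)
    set n := addOrderOf (QuotientAddGroup.mk (-(c * q)) : ℂ ⧸ AddSubgroup.zmultiples c)
    rw [← QuotientAddGroup.mk_nsmul, QuotientAddGroup.eq_zero_iff,
      AddSubgroup.mem_zmultiples_iff] at h
    obtain ⟨m, hm⟩ := h
    simp only [zsmul_eq_mul, nsmul_eq_mul] at hm
    -- Cancelling `c` shows that `n q` is an integer, an identity that descends from `ℂ` to `ℚ` and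
    -- then to `ℤ`.
    have h1 : ((n : ℂ) * q) = ((-m : ℤ) : ℂ) := by
      refine mul_left_cancel₀ hc ?_
      push_cast
      linear_combination hm
    have h2 : (n : ℚ) * q = ((-m : ℤ) : ℚ) := by exact_mod_cast h1
    have h3 : (n : ℤ) * q.num = -m * q.den := by
      have h4 := Rat.mul_den_eq_num q
      have : ((n : ℚ) * q.num) = ((-m : ℤ) : ℚ) * q.den := by
        rw [← h4, ← h2]
        ring
      exact_mod_cast this
    have h5 : (q.den : ℤ) ∣ n * q.num := ⟨-m, by rw [h3]; ring⟩
    -- Lowest terms: the denominator divides `n * q.num`, hence `n`.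
    have hcop : IsCoprime (q.den : ℤ) q.num := by
      rw [Int.isCoprime_iff_nat_coprime]
      simpa using q.reduced.symm
    exact_mod_cast hcop.dvd_of_dvd_mul_right h5

end HigherChow

/-! ### The combined precycle -/

theorem mainTheorem2 (r ℓ : ℕ) (hr : 1 ≤ r) [NeZero ℓ]
    (Z : ZMod ℓ → HigherChow.closedNR (HigherChow.CyclotomicSubfield ℓ) r ((r - 1) * 2))
    (hZ : ∀ a : ZMod ℓ, (r = 1 → a ≠ 0) →
      HigherChow.AJ (HigherChow.CyclotomicSubfield ℓ) r (Z a) =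
        QuotientAddGroup.mk (HigherChow.polylogValue r ℓ a))
    (f : ZMod ℓ → ℤ) (hf : ∀ a, f (-a) = (-1) ^ r * f a) :
    IsOfFinAddOrder (HigherChow.AJ (HigherChow.CyclotomicSubfield ℓ) r (∑ a, f a • Z a)) ∧
    addOrderOf (HigherChow.AJ (HigherChow.CyclotomicSubfield ℓ) r (∑ a, f a • Z a)) =
      (HigherChow.bernoulliSum r ℓ f).den ∧
    HigherChow.AJ (HigherChow.CyclotomicSubfield ℓ) r (∑ a, f a • Z a) =
      QuotientAddGroup.mk
        (-((2 * Real.pi * Complex.I) ^ r * (HigherChow.bernoulliSum r ℓ f : ℂ))) ∧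
    ((∀ a : ZMod ℓ, (r = 1 → a ≠ 0) →
        HigherChow.regulatorNR (HigherChow.CyclotomicSubfield ℓ) r (Z a) =
          HigherChow.polylogValue r ℓ a) →
      HigherChow.tau r (∑ a, f a • Z a) = |(HigherChow.bernoulliSum r ℓ f : ℝ)|) := by
  have hc : ((2 * Real.pi * Complex.I) ^ r : ℂ) ≠ 0 := pow_ne_zero _ Complex.two_pi_I_ne_zero
  -- For `r = 1` nothing is assumed about `Z 0`; oddness of `f` removes it from the sum.
  have hf0 : r = 1 → f 0 = 0 := by
    rintro rfl
    have h0 := hf 0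
    rw [neg_zero] at h0
    omega
  have hAJ : HigherChow.AJ (HigherChow.CyclotomicSubfield ℓ) r (∑ a, f a • Z a) =
      QuotientAddGroup.mk
        (-((2 * Real.pi * Complex.I) ^ r * (HigherChow.bernoulliSum r ℓ f : ℂ))) := by
    rw [← HigherChow.sum_mul_polylogValue hr f hf, map_sum, ← QuotientAddGroup.mk'_apply, map_sum]
    refine Finset.sum_congr rfl fun a _ => ?_
    rw [map_zsmul, ← zsmul_eq_mul, map_zsmul]
    by_cases ha : r = 1 → a ≠ 0
    · rw [hZ a ha, QuotientAddGroup.mk'_apply]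
    · push Not at ha
      rw [ha.2, hf0 ha.1, zero_zsmul, zero_zsmul]
  have hord := HigherChow.addOrderOf_mk_neg_mul_ratCast hc (HigherChow.bernoulliSum r ℓ f)
  refine ⟨?_, hAJ ▸ hord, hAJ, fun hR => ?_⟩
  · rw [← addOrderOf_pos_iff, hAJ, hord]
    exact Rat.den_pos _
  -- The same computation before passing to the quotient: `regulatorNR` is itself additive, so exact
  -- values on the `Z a` give an exact value on the sum.
  · have hreg : HigherChow.regulatorNR (HigherChow.CyclotomicSubfield ℓ) r (∑ a, f a • Z a) =
        -((2 * Real.pi * Complex.I) ^ r * (HigherChow.bernoulliSum r ℓ f : ℂ)) := by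
      rw [← HigherChow.sum_mul_polylogValue hr f hf, map_sum]
      refine Finset.sum_congr rfl fun a _ => ?_
      rw [map_zsmul, zsmul_eq_mul]
      by_cases ha : r = 1 → a ≠ 0
      · rw [hR a ha]
      · push Not at ha
        simp [ha.2, hf0 ha.1]
    rw [HigherChow.tau, hreg, mul_neg, inv_mul_cancel_left₀ hc, norm_neg, ← Complex.ofReal_ratCast,
      Complex.norm_real, Real.norm_eq_abs]
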